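/- Let $G$ be a compact connected (real, finite-dimensional) Lie group with trivial center and Lie algebra $\mathfrak g$. The negative of the Killing form is an $\operatorname{Ad}$-invariant positive-definite inner product on $\mathfrak g$; let $\|\cdot\|_{\mathfrak g}$ be its norm and $\angle(x,y)\in[0,\pi]$ the angle between two nonzero vectors with respect to it. For $g\in G$ put $$|g|_G=\sup_{\|y\|_{\mathfrak g}=1}\angle\bigl(y,\operatorname{Ad}_g y\bigr)$$ (with $|g|_G=0$ if $\mathfrak g=0$). Let $\alpha$ be the smallest positive real number with $\cos\alpha=\tfrac78$. Let $H\subseteq G$ be a discrete subgroup and let $h,k\in H$ satisfy $|h|_G<\frac{\pi}{2}$ and $|k|_G<\alpha$. Then $[h,k]=hkh^{-1}k^{-1}=1$, that is, $h$ and $k$ commute. -/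

import Mathlib

open scoped Manifold ContDiff commutatorElement

section LieGroupOperatorNorm

variable {E : Type*} [NormedAddCommGroup E] [NormedSpace ℝ E]
  {M : Type*} [TopologicalSpace M] (I : ModelWithCorners ℝ E M)
  {G : Type*} [TopologicalSpace G] [ChartedSpace M G] [Group G]

/-- A smooth real Lie group has enough smoothness for Mathlib's Lie algebra structure on the
tangent space at the identity, `GroupLieAlgebra I G`. -/
instance LieGroup.instMinSmoothnessThree [LieGroup I ∞ G] :
    LieGroup I (minSmoothness ℝ 3) G := by
  rw [minSmoothness_of_isRCLikeNormedField]
  infer_instance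

/-- The adjoint action `Ad g`: the derivative at the identity of `x ↦ g * x * g⁻¹`.
(The target of the derivative is the tangent space at `g * 1 * g⁻¹`, which is the identity.) -/
noncomputable def LieGroup.Ad (g : G) : GroupLieAlgebra I G →L[ℝ] GroupLieAlgebra I G :=
  mfderiv I I (fun x : G => g * x * g⁻¹) (1 : G)

variable [FiniteDimensional ℝ E] [LieGroup I ∞ G]

/-- The negative of the Killing form of the Lie algebra of `G`. -/
noncomputable def LieGroup.killingInner (x y : GroupLieAlgebra I G) : ℝ :=
  -killingForm ℝ (GroupLieAlgebra I G) x y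

/-- The norm on the Lie algebra induced by the negative of the Killing form. -/
noncomputable def LieGroup.killingNorm (x : GroupLieAlgebra I G) : ℝ :=
  √(LieGroup.killingInner I x x)

/-- The absolute value, in `[0, π]`, of the angle between two vectors of the Lie algebra, with
respect to the negative of the Killing form. -/
noncomputable def LieGroup.killingAngle (x y : GroupLieAlgebra I G) : ℝ :=
  Real.arccos (LieGroup.killingInner I x y /
    (LieGroup.killingNorm I x * LieGroup.killingNorm I y))

/-- The operator norm of `g`: the supremum, over the unit vectors `y` of the Lie algebra, of the
angle between `y` and `Ad g y`. All angles are in `[0, π]`, so this is a supremum of a bounded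
set; it is `0` if the Lie algebra is zero. -/
noncomputable def LieGroup.opNorm (g : G) : ℝ :=
  sSup {θ : ℝ | ∃ y : GroupLieAlgebra I G, LieGroup.killingNorm I y = 1 ∧
    θ = LieGroup.killingAngle I y (LieGroup.Ad I g y)}

end LieGroupOperatorNorm

/-! A discrete subgroup of a compact Hausdorff group is finite. The centre is trivial and `G` is
connected, so `Ad` is faithful and the problem concerns a finite group of isometries of the Lie
algebra. For isometries, `ab - ba = (a - 1)(b - 1) - (b - 1)(a - 1)`, so taking the commutator with
`k` multiplies displacement by at most `2d`, where `d` bounds the displacement of `k`. The condition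
`cos α = 7/8` is the one giving `d < 1/2`, since `2 - 2 * (7/8) = 1/4`. The iterated commutators
`[[h, k], k], ...` thus tend to the identity, and by finiteness they reach it. One then descends: if
`[a, k]` commutes with `k` and `a` moves vectors by less than `π / 2`, an averaging argument gives
`[a, k] = 1` (`map_commutator_eq_one_of_commute`).

The Lie-theoretic input is that minus the Killing form is `Ad`-invariant and positive definite. The
derivative of `Ad` is the bracket (`adModel_apply`). It is skew for a Haar-averaged inner product
and injective because `Ad` is, so `ad x ∘ ad x` has negative trace for `x ≠ 0`. -/

/-! ### Finite groups of isometries. -/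

section LinearAlgebra

/-- The displacement of a commutator of isometries is at most twice the product of the
displacements. -/
theorem norm_commutator_sub_le {V : Type*} [NormedAddCommGroup V] [InnerProductSpace ℝ V]
    {Γ : Type*} [Group Γ] (ρ : Γ →* (V →ₗ[ℝ] V)) (hρ : ∀ g v, ‖ρ g v‖ = ‖v‖)
    {a b : Γ} {c d : ℝ} (hc : 0 ≤ c) (hd : 0 ≤ d)
    (ha : ∀ v, ‖ρ a v - v‖ ≤ c * ‖v‖) (hb : ∀ v, ‖ρ b v - v‖ ≤ d * ‖v‖) (v : V) :
    ‖ρ ⁅a, b⁆ v - v‖ ≤ 2 * d * c * ‖v‖ := by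
  -- With this `w` the displacement is `(ab - ba) w`, which equals `(a - 1)(b - 1) w - (b - 1)(a -
  -- 1) w`.
  set w := ρ (a⁻¹ * b⁻¹) v with hw
  have hwn : ‖w‖ = ‖v‖ := hρ _ _
  have e1 : ρ ⁅a, b⁆ v = ρ a (ρ b w) := by
    rw [hw, ← Module.End.mul_apply, ← Module.End.mul_apply, ← map_mul, ← map_mul,
      commutatorElement_def]
    group
  have e2 : v = ρ b (ρ a w) := by
    rw [hw, ← Module.End.mul_apply, ← Module.End.mul_apply, ← map_mul, ← map_mul]
    simp
  have e3 : ρ ⁅a, b⁆ v - v =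
      (ρ a (ρ b w - w) - (ρ b w - w)) - (ρ b (ρ a w - w) - (ρ a w - w)) := by
    rw [e1]
    conv_lhs => rw [e2]
    simp only [map_sub]
    abel
  rw [e3]
  calc _ ≤ ‖ρ a (ρ b w - w) - (ρ b w - w)‖ + ‖ρ b (ρ a w - w) - (ρ a w - w)‖ := norm_sub_le _ _
    _ ≤ c * (d * ‖w‖) + d * (c * ‖w‖) := by
        gcongr
        · exact (ha _).trans (by gcongr; exact hb _)
        · exact (hb _).trans (by gcongr; exact ha _)
    _ = 2 * d * c * ‖v‖ := by rw [hwn]; ring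

open scoped InnerProductSpace in
/-- If `b` commutes with `⁅a, b⁆`, where `a`, `b` lie in a finite group of isometries and `a` moves
every vector by an angle less than `π / 2`, then `⁅a, b⁆` acts trivially. -/
theorem map_commutator_eq_one_of_commute {V : Type*} [NormedAddCommGroup V] [InnerProductSpace ℝ V]
    {Γ : Type*} [Group Γ] [Finite Γ] (ρ : Γ →* (V →ₗ[ℝ] V))
    (hρ : ∀ g v w, ⟪ρ g v, ρ g w⟫_ℝ = ⟪v, w⟫_ℝ)
    {a b : Γ} (ha : ∀ v, v ≠ 0 → 0 < ⟪ρ a v, v⟫_ℝ) (hab : Commute ⁅a, b⁆ b) :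
    ρ ⁅a, b⁆ = 1 := by
  set d := ⁅a, b⁆ with hd
  -- From `d b = a b a⁻¹` and `d b = b d` one gets `d ^ i b ^ i = a b ^ i a⁻¹`.
  have key : ∀ i : ℕ, b ^ i * a * (b ^ i)⁻¹ = (d ^ i)⁻¹ * a := by
    intro i
    have h1 : d ^ i * b ^ i = a * b ^ i * a⁻¹ := by
      rw [← hab.mul_pow, ← conj_pow]
      simp [hd, commutatorElement_def]
    have h2 : b ^ i * d ^ i = a * b ^ i * a⁻¹ := by rw [← h1, (hab.pow_pow i i).eq]
    have h3 : b ^ i = a * b ^ i * a⁻¹ * (d ^ i)⁻¹ := by rw [← h2]; group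
    have h4 : b ^ i = (d ^ i)⁻¹ * (a * b ^ i * a⁻¹) := by rw [← h1]; group
    calc b ^ i * a * (b ^ i)⁻¹ = ((d ^ i)⁻¹ * (a * b ^ i * a⁻¹)) * a * (b ^ i)⁻¹ := by rw [← h4]
      _ = _ := by group
  have adj : ∀ (g : Γ) v w, ⟪ρ g⁻¹ v, w⟫_ℝ = ⟪v, ρ g w⟫_ℝ := by
    intro g v w
    rw [← hρ g, ← Module.End.mul_apply, ← map_mul]
    simp
  ext y
  set m := Nat.card Γ
  have hm : 0 < m := Nat.card_pos
  set x := ρ d y - y with hx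
  -- The sum telescopes to `d ^ m y - y`, and `d ^ m = 1` as `m` is the group order.
  have hsum : ∑ i ∈ Finset.range m, ρ (d ^ i) x = 0 := by
    have : ∀ i, ρ (d ^ i) x = ρ (d ^ (i + 1)) y - ρ (d ^ i) y := by
      intro i
      rw [hx, map_sub, ← Module.End.mul_apply, ← map_mul, pow_succ]
    simp only [this]
    rw [Finset.sum_range_sub (fun i => ρ (d ^ i) y)]
    simp [m]
  have hterm : ∀ i : ℕ, ⟪ρ a (ρ (b ^ i)⁻¹ x), ρ (b ^ i)⁻¹ x⟫_ℝ = ⟪ρ a x, ρ (d ^ i) x⟫_ℝ := by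
    intro i
    rw [← adj (d ^ i), ← Module.End.mul_apply (ρ _) (ρ a), ← map_mul, ← key i, map_mul, map_mul,
      Module.End.mul_apply, Module.End.mul_apply, ← hρ (b ^ i),
      ← Module.End.mul_apply (ρ (b ^ i)) (ρ (b ^ i)⁻¹), ← map_mul]
    simp
  have hx0 : x = 0 := by
    by_contra hne
    -- Each term is positive by the angle condition on `a`, yet by `hterm` the sum is `ρ a x` paired
    -- with the vanishing sum `hsum`.
    have hpos : 0 < ∑ i ∈ Finset.range m, ⟪ρ a (ρ (b ^ i)⁻¹ x), ρ (b ^ i)⁻¹ x⟫_ℝ := by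
      refine Finset.sum_pos (fun i _ => ha _ fun h0 => hne ?_) ⟨0, by simpa using hm⟩
      have := congrArg (ρ (b ^ i)) h0
      rw [← Module.End.mul_apply, ← map_mul] at this
      simpa using this
    simp only [hterm] at hpos
    rw [← inner_sum, hsum, inner_zero_right] at hpos
    exact lt_irrefl _ hpos
  simpa [hx, sub_eq_zero] using hx0

open scoped InnerProductSpace in
/-- In a finite group with a faithful orthogonal representation, an element moving every vector by
an angle less than `π / 2` commutes with every element whose displacement is less than `1 / 2`. -/
theorem commutatorElement_eq_one_of_displacement {V : Type*} [NormedAddCommGroup V]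
    [InnerProductSpace ℝ V]
    {Γ : Type*} [Group Γ] [Finite Γ] (ρ : Γ →* (V →ₗ[ℝ] V)) (hinj : Function.Injective ρ)
    (hρ : ∀ g v w, ⟪ρ g v, ρ g w⟫_ℝ = ⟪v, w⟫_ℝ)
    {a b : Γ} (ha : ∀ v, v ≠ 0 → 0 < ⟪ρ a v, v⟫_ℝ)
    {d : ℝ} (hd0 : 0 ≤ d) (hd : d < 1 / 2) (hb : ∀ v, ‖ρ b v - v‖ ≤ d * ‖v‖) :
    ⁅a, b⁆ = 1 := by
  have hnorm : ∀ g v, ‖ρ g v‖ = ‖v‖ := fun g v => by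
    rw [@norm_eq_sqrt_real_inner V, @norm_eq_sqrt_real_inner V, hρ]
  have hsq : ∀ g v, ‖ρ g v - v‖ ^ 2 = 2 * ‖v‖ ^ 2 - 2 * ⟪ρ g v, v⟫_ℝ := fun g v => by
    rw [norm_sub_sq_real, hnorm]; ring
  let f : ℕ → Γ := fun n => (fun x => ⁅x, b⁆)^[n] a
  have hf : ∀ n, f (n + 1) = ⁅f n, b⁆ := fun n => Function.iterate_succ_apply' _ _ _
  -- The factor `√2` is the displacement of a unit vector turned by `π / 2`. A displacement below it
  -- means a positive inner product, so the angle condition survives iteration.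
  have hbound : ∀ n v, ‖ρ (f n) v - v‖ ≤ (2 * d) ^ n * √2 * ‖v‖ := by
    intro n
    induction n with
    | zero =>
      intro v
      refine abs_le_of_sq_le_sq' ?_ (by positivity) |>.2
      rw [hsq, mul_pow, mul_pow, Real.sq_sqrt (by norm_num)]
      have : 0 ≤ ⟪ρ (f 0) v, v⟫_ℝ := by
        rcases eq_or_ne v 0 with rfl | hv
        · simp
        · exact (ha v hv).le
      simp only [pow_zero, one_pow]
      linarith
    | succ n ih =>
      intro v
      rw [hf]
      refine (norm_commutator_sub_le ρ hnorm (by positivity) hd0 ih hb v).trans (le_of_eq ?_)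
      ring
  have hpos : ∀ n v, v ≠ 0 → 0 < ⟪ρ (f n) v, v⟫_ℝ := by
    intro n v hv
    rcases n with _ | n
    · exact ha v hv
    · have h1 := hbound (n + 1) v
      have hv' : 0 < ‖v‖ := norm_pos_iff.2 hv
      have h2 : (2 * d) ^ (n + 1) < 1 := pow_lt_one₀ (by positivity) (by linarith) (by simp)
      have h3 : ‖ρ (f (n + 1)) v - v‖ < √2 * ‖v‖ := h1.trans_lt (by
        have : 0 < √2 * ‖v‖ := by positivity
        nlinarith)
      have h4 := pow_lt_pow_left₀ h3 (norm_nonneg _) two_ne_zero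
      rw [hsq, mul_pow, Real.sq_sqrt (by norm_num)] at h4
      linarith
  -- If `f (n + 2) = 1`, then `f (n + 1) = ⁅f n, b⁆` commutes with `b` and is trivial by the
  -- averaging lemma.
  have hdesc : ∀ n, f n = 1 → ⁅a, b⁆ = 1 := by
    intro n
    induction n with
    | zero => intro h; simp [show a = 1 from h]
    | succ n ih =>
      rcases n with _ | n
      · intro h; exact h
      · intro h
        apply ih
        have hc : Commute ⁅f n, b⁆ b := by
          rw [← hf, ← commutatorElement_eq_one_iff_commute, ← hf]; exact h
        apply hinj
        rw [hf, map_commutator_eq_one_of_commute ρ hρ (hpos n) hc, map_one]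
  -- Some `X` occurs for arbitrarily large `n`, so its displacement lies below every `ε`.
  obtain ⟨X, hX⟩ := Finite.exists_infinite_fiber f
  suffices h : ρ X = 1 by
    obtain ⟨n, hn⟩ := hX.nonempty
    exact hdesc n (hinj (by rw [show f n = X from hn, h, map_one]))
  ext v
  rw [Module.End.one_apply, ← sub_eq_zero, ← norm_le_zero_iff]
  have hlim : Filter.Tendsto (fun n : ℕ => (2 * d) ^ n * √2 * ‖v‖) Filter.atTop (nhds 0) := by
    have := tendsto_pow_atTop_nhds_zero_of_lt_one (r := 2 * d) (by positivity) (by linarith)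
    simpa using (this.mul_const (√2)).mul_const ‖v‖
  refine le_of_forall_pos_lt_add fun ε hε => ?_
  obtain ⟨N, hN⟩ := Filter.eventually_atTop.1 (hlim.eventually (gt_mem_nhds hε))
  obtain ⟨n, hn, hNn⟩ := (Set.infinite_coe_iff.1 hX).exists_gt N
  have := hbound n v
  rw [show f n = X from hn] at this
  linarith [hN n hNn.le]

end LinearAlgebra

/-! ### The adjoint representation and its derivative. -/

namespace LieGroup

variable {E : Type*} [NormedAddCommGroup E] [NormedSpace ℝ E]
  {M : Type*} [TopologicalSpace M] (I : ModelWithCorners ℝ E M)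
  {G : Type*} [TopologicalSpace G] [ChartedSpace M G]

/-- Transports derivatives between base points that are only propositionally equal, all tangent
spaces being `E`. -/
theorem hasMFDerivAt_of_eq {f : G → G} {x y : G} (hf : MDifferentiableAt I I f x) (h : y = x) :
    HasMFDerivAt I I f y (mfderiv I I f x : E →L[ℝ] E) := by
  subst h; exact hf.hasMFDerivAt

variable [Group G]

/-- The adjoint action, as a map into the endomorphisms of the model space. -/
noncomputable def AdModel (g : G) : E →L[ℝ] E := Ad I g

theorem Ad_one : Ad I (1 : G) = ContinuousLinearMap.id ℝ (GroupLieAlgebra I G) := by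
  have : (fun x : G => 1 * x * 1⁻¹) = id := by ext; simp
  unfold Ad
  rw [this]
  exact mfderiv_id

variable (G) in
/-- The derivative at the identity of the adjoint action. -/
noncomputable def adModel :
    E →L[ℝ] E →L[ℝ] E :=
  mfderiv I 𝓘(ℝ, E →L[ℝ] E) (AdModel I (G := G)) 1

variable (G) in
/-- The multiplication of a Lie group, read in the chart at the identity. -/
noncomputable def chartMul (p : E × E) : E :=
  extChartAt I (1 : G) ((extChartAt I (1 : G)).symm p.1 * (extChartAt I (1 : G)).symm p.2)

theorem chartMul_right_one_eventuallyEq [I.Boundaryless] :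
    (fun a => chartMul I G (a, extChartAt I (1 : G) 1)) =ᶠ[nhds (extChartAt I (1 : G) 1)] id := by
  filter_upwards [extChartAt_target_mem_nhds (I := I) (1 : G)] with a ha
  rw [chartMul, extChartAt_to_inv, mul_one, (extChartAt I (1 : G)).right_inv ha, id]

theorem chartMul_left_one_eventuallyEq [I.Boundaryless] :
    (fun b => chartMul I G (extChartAt I (1 : G) 1, b)) =ᶠ[nhds (extChartAt I (1 : G) 1)] id := by
  filter_upwards [extChartAt_target_mem_nhds (I := I) (1 : G)] with a ha
  rw [chartMul, extChartAt_to_inv, one_mul, (extChartAt I (1 : G)).right_inv ha, id]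

theorem AdModel_one : AdModel I (1 : G) = ContinuousLinearMap.id ℝ E := Ad_one I

variable [LieGroup I ∞ G]

theorem contMDiff_conj (g : G) : ContMDiff I I ∞ (fun x : G => g * x * g⁻¹) :=
  (contMDiff_mul_right (a := g⁻¹)).comp (contMDiff_mul_left (a := g))

theorem mdifferentiableAt_conj (g x : G) : MDifferentiableAt I I (fun x : G => g * x * g⁻¹) x :=
  (contMDiff_conj I g).mdifferentiableAt (by simp)

theorem Ad_mul (g h : G) : Ad I (g * h) = (Ad I g).comp (Ad I h) := by
  have e : (fun x : G => g * h * x * (g * h)⁻¹) =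
      (fun x : G => g * x * g⁻¹) ∘ (fun x : G => h * x * h⁻¹) := by
    ext; simp [mul_assoc]
  unfold Ad
  rw [e]
  have := mfderiv_comp (1 : G) (mdifferentiableAt_conj I g (h * 1 * h⁻¹))
    (mdifferentiableAt_conj I h 1)
  rw [this]
  congr 2
  simp

/-- The derivative of a smooth family is smooth in tangent coordinates. Here both base points stay
at the identity, so the coordinate changes are trivial and the family is `AdModel` itself. -/
theorem contMDiff_AdModel :
    ContMDiff I 𝓘(ℝ, E →L[ℝ] E) ∞ (AdModel I (G := G)) := by
  intro g₀
  have hf : ContMDiffAt (I.prod I) I ∞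
      (Function.uncurry (fun g x : G => g * x * g⁻¹)) (g₀, (1 : G)) := by
    have : ContMDiff (I.prod I) I ∞ (fun p : G × G => p.1 * p.2 * p.1⁻¹) :=
      (contMDiff_fst.mul contMDiff_snd).mul contMDiff_fst.inv
    exact this.contMDiffAt
  have h := ContMDiffAt.mfderiv (m := ∞) (fun g x : G => g * x * g⁻¹) (fun _ : G => (1 : G)) hf
    contMDiffAt_const (by simp)
  refine h.congr_of_eventuallyEq (Filter.Eventually.of_forall fun g => ?_)
  have e0 : g₀ * 1 * g₀⁻¹ = (1 : G) := by simp
  have e1 : g * 1 * g⁻¹ = (1 : G) := by simp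
  have hk : (mfderiv I 𝓘(ℝ, E) (extChartAt I (g₀ * 1 * g₀⁻¹)) (g * 1 * g⁻¹) : E →L[ℝ] E) =
      ContinuousLinearMap.id ℝ E := by
    rw [e0, e1]; exact mfderiv_extChartAt_self
  have hl : (mfderivWithin 𝓘(ℝ, E) I (extChartAt I (1 : G)).symm (Set.range I)
      (extChartAt I (1 : G) 1) : E →L[ℝ] E) = ContinuousLinearMap.id ℝ E :=
    mfderivWithin_range_extChartAt_symm
  have h2 := inTangentCoordinates_eq_mfderiv_comp (I := I) (I' := I) (f := fun _ : G => (1 : G))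
    (g := fun g : G => g * 1 * g⁻¹) (ϕ := fun g => mfderiv I I (fun x : G => g * x * g⁻¹) 1)
    (x₀ := g₀) (x := g) (by simp) (by simp)
  refine Eq.trans ?_ h2.symm
  change AdModel I g = ContinuousLinearMap.comp
    (mfderiv I 𝓘(ℝ, E) (extChartAt I (g₀ * 1 * g₀⁻¹)) (g * 1 * g⁻¹) : E →L[ℝ] E)
    ((AdModel I g).comp (mfderivWithin 𝓘(ℝ, E) I (extChartAt I (1 : G)).symm (Set.range I)
      (extChartAt I (1 : G) 1) : E →L[ℝ] E))
  rw [hk, hl]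
  rfl

theorem AdModel_mul (g h : G) : AdModel I (g * h) = (AdModel I g).comp (AdModel I h) :=
  Ad_mul I g h

theorem mdifferentiableAt_AdModel (g : G) :
    MDifferentiableAt I 𝓘(ℝ, E →L[ℝ] E) (AdModel I (G := G)) g :=
  (contMDiff_AdModel I).mdifferentiableAt (by simp)

theorem mfderiv_AdModel_comp {f : G → G} {x y : G} (hf : MDifferentiableAt I I f x)
    (hy : f x = y) (v : E) :
    (mfderiv I 𝓘(ℝ, E →L[ℝ] E) (AdModel I (G := G) ∘ f) x v : E →L[ℝ] E) =
      mfderiv I 𝓘(ℝ, E →L[ℝ] E) (AdModel I (G := G)) y (mfderiv I I f x v : E) := by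
  subst hy
  exact DFunLike.congr_fun (mfderiv_comp x (mdifferentiableAt_AdModel I (f x)) hf) v

theorem mfderiv_clm_comp_AdModel (T : (E →L[ℝ] E) →L[ℝ] (E →L[ℝ] E)) (v : E) :
    (mfderiv I 𝓘(ℝ, E →L[ℝ] E) (T ∘ AdModel I (G := G)) 1 v : E →L[ℝ] E) =
      T (adModel I G v) :=
  DFunLike.congr_fun (HasMFDerivAt.comp (1 : G) T.hasFDerivAt.hasMFDerivAt
      (mdifferentiableAt_AdModel I (1 : G)).hasMFDerivAt).mfderiv v

/-- Differentiate `Ad (g b) = Ad g ∘ Ad b` in `b` at the identity. -/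
theorem mfderiv_AdModel_mulInvariantVectorField (g : G) (x : GroupLieAlgebra I G) :
    (mfderiv I 𝓘(ℝ, E →L[ℝ] E) (AdModel I (G := G)) g (mulInvariantVectorField x g) : E →L[ℝ] E) =
      (AdModel I g).comp (adModel I G x) := by
  have hL : MDifferentiableAt I I (fun b : G => g * b) 1 :=
    (contMDiff_mul_left (I := I) (n := ∞)).mdifferentiableAt (by simp)
  have e : AdModel I (G := G) ∘ (fun b : G => g * b) =
      ContinuousLinearMap.compL ℝ E E E (AdModel I g) ∘ AdModel I (G := G) := by
    ext1 b
    exact AdModel_mul I g b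
  have h1 := mfderiv_AdModel_comp I hL (mul_one g) x
  rw [e] at h1
  exact h1.symm.trans (mfderiv_clm_comp_AdModel I _ x)

/-- Differentiate `Ad (g b g⁻¹) = Ad g ∘ Ad b ∘ Ad g⁻¹` in `b`. This yields the invariance of the
Killing form. -/
theorem adModel_Ad (g : G) (x : E) :
    adModel I G (AdModel I g x) = (AdModel I g).comp ((adModel I G x).comp (AdModel I g⁻¹)) := by
  let T : (E →L[ℝ] E) →L[ℝ] (E →L[ℝ] E) :=
    (ContinuousLinearMap.compL ℝ E E E (AdModel I g)).comp
      ((ContinuousLinearMap.compL ℝ E E E).flip (AdModel I g⁻¹))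
  have e : AdModel I (G := G) ∘ (fun b : G => g * b * g⁻¹) = T ∘ AdModel I (G := G) := by
    ext1 b
    simp [T, AdModel_mul, ContinuousLinearMap.comp_assoc]
  have h1 := mfderiv_AdModel_comp I (mdifferentiableAt_conj I g 1) (y := 1) (by simp) x
  rw [e] at h1
  exact h1.symm.trans (mfderiv_clm_comp_AdModel I _ x)

/-! ### The kernels of the adjoint action and of its derivative. -/

/-- A map with vanishing derivative is locally constant. -/
theorem eventually_eq_of_hasMFDerivAt_zero [I.Boundaryless] {f : G → G}
    (hf : ∀ y, HasMFDerivAt I I f y 0) (x : G) : ∀ᶠ y in nhds x, f y = f x := by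
  set φ := extChartAt I x with hφ
  set χ := extChartAt I (f x) with hχ
  have hψ : ContinuousAt φ.symm (φ x) := continuousAt_extChartAt_symm x
  have hs : ∀ᶠ a in nhds (φ x), a ∈ φ.target ∧ f (φ.symm a) ∈ χ.source := by
    refine Filter.Eventually.and (extChartAt_target_mem_nhds (I := I) x) ?_
    have hc : ContinuousAt f (φ.symm (φ x)) := (hf _).continuousAt
    refine (hc.comp hψ).eventually ?_
    have : φ.symm (φ x) = x := extChartAt_to_inv x
    simp only [Function.comp_apply, this]
    exact extChartAt_source_mem_nhds (I := I) (f x)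
  obtain ⟨ε, hε, hball⟩ := Metric.eventually_nhds_iff_ball.1 hs
  have hd : ∀ a ∈ Metric.ball (φ x) ε,
      HasFDerivAt (χ ∘ f ∘ φ.symm) (0 : E →L[ℝ] E) a := by
    intro a ha
    obtain ⟨h1, h2⟩ := hball a ha
    have h3 : MDifferentiableAt 𝓘(ℝ, E) I φ.symm a := by
      have := mdifferentiableWithinAt_extChartAt_symm (I := I) h1
      rwa [I.range_eq_univ, mdifferentiableWithinAt_univ] at this
    have h4 : MDifferentiableAt I 𝓘(ℝ, E) χ (f (φ.symm a)) :=
      mdifferentiableAt_extChartAt (by simpa [hχ] using h2)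
    have h5 := (HasMFDerivAt.comp a h4.hasMFDerivAt
      (HasMFDerivAt.comp a (hf (φ.symm a)) h3.hasMFDerivAt)).hasFDerivAt
    refine h5.congr_fderiv ?_
    ext1 v
    exact map_zero (mfderiv I 𝓘(ℝ, E) χ (f (φ.symm a)))
  have hconst : ∀ a ∈ Metric.ball (φ x) ε, f (φ.symm a) = f x := by
    intro a ha
    have hx := Metric.mem_ball_self (x := φ x) hε
    have h6 := (convex_ball (φ x) ε).is_const_of_fderivWithin_eq_zero (𝕜 := ℝ)
      (f := χ ∘ f ∘ φ.symm)
      (fun s hs => (hd s hs).differentiableAt.differentiableWithinAt)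
      (fun s hs => by
        rw [fderivWithin_of_isOpen Metric.isOpen_ball hs, (hd s hs).fderiv]) ha hx
    have h7 := χ.injOn (hball a ha).2 (hball _ hx).2 h6
    rw [h7]
    exact congrArg f (extChartAt_to_inv x)
  have hφc : ContinuousAt φ x := continuousAt_extChartAt x
  filter_upwards [hφc.eventually (Metric.ball_mem_nhds _ hε), extChartAt_source_mem_nhds (I := I) x]
    with y hy1 hy2
  have := hconst _ hy1
  rwa [φ.left_inv hy2] at this

theorem contMDiff_commutator (g : G) : ContMDiff I I ∞ (fun x : G => g * x * g⁻¹ * x⁻¹) :=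
  (contMDiff_conj I g).mul contMDiff_id.inv

/-- With `u x = g x g⁻¹ x⁻¹`, differentiating `u x * x = g x g⁻¹` at the identity gives `Du v + v =
Ad g v = v`. -/
theorem hasMFDerivAt_commutator_one {g : G} (hg : AdModel I g = ContinuousLinearMap.id ℝ E) :
    HasMFDerivAt I I (fun x : G => g * x * g⁻¹ * x⁻¹) 1 0 := by
  set u : G → G := fun x => g * x * g⁻¹ * x⁻¹ with hu
  have hu1 : u 1 = 1 := by simp [hu]
  have hd : MDifferentiableAt I I u 1 := (contMDiff_commutator I g).mdifferentiableAt (by simp)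
  have hm : MDifferentiableAt (I.prod I) I (fun p : G × G => p.1 * p.2) (u 1, 1) :=
    (contMDiff_mul I ∞).mdifferentiableAt (by simp)
  have hw : MDifferentiableAt I (I.prod I) (fun x : G => (u x, id x)) 1 :=
    hd.prodMk mdifferentiableAt_id
  have hc := mfderiv_comp (1 : G) (f := fun x : G => (u x, id x)) hm hw
  have e : (fun p : G × G => p.1 * p.2) ∘ (fun x => (u x, id x)) = fun x : G => g * x * g⁻¹ := by
    ext x; simp [hu]
  have hl : (mfderiv I I (fun z : G => z * (1 : G)) (u 1) : E →L[ℝ] E) =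
      ContinuousLinearMap.id ℝ E := by
    have : (fun z : G => z * (1 : G)) = id := by ext; simp
    rw [this]; exact mfderiv_id
  have hr : (mfderiv I I (fun z : G => u 1 * z) 1 : E →L[ℝ] E) =
      ContinuousLinearMap.id ℝ E := by
    have : (fun z : G => u 1 * z) = id := by ext; simp [hu1]
    rw [this]; exact mfderiv_id
  have key : ∀ v : E, (mfderiv I I u 1 : E →L[ℝ] E) v = 0 := by
    intro v
    have h1 : (AdModel I g v : E) = mfderiv (I.prod I) I (fun p : G × G => p.1 * p.2) (u 1, 1)
        (mfderiv I (I.prod I) (fun x : G => (u x, id x)) 1 v) := by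
      refine Eq.trans ?_ (DFunLike.congr_fun hc v)
      rw [e]
      rfl
    have h2 := mfderiv_prod_eq_add_apply (v := (mfderiv I (I.prod I) (fun x => (u x, id x)) 1 v)) hm
    have h3 : ((mfderiv I (I.prod I) (fun x => (u x, id x)) 1 v : E × E)) =
        ((mfderiv I I u 1 : E →L[ℝ] E) v, v) := by
      rw [hd.mfderiv_prod mdifferentiableAt_id, mfderiv_id]
      rfl
    have h4 : (AdModel I g v : E) =
        (mfderiv I I (fun z : G => z * (1 : G)) (u 1) : E →L[ℝ] E)
          (mfderiv I (I.prod I) (fun x => (u x, id x)) 1 v : E × E).1 +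
        (mfderiv I I (fun z : G => u 1 * z) 1 : E →L[ℝ] E)
          (mfderiv I (I.prod I) (fun x => (u x, id x)) 1 v : E × E).2 := h1.trans h2
    rw [hl, hr, h3, hg] at h4
    let D : E →L[ℝ] E := mfderiv I I u 1
    have h5 : v = D v + v := h4
    exact right_eq_add.1 h5
  have h0 : mfderiv I I u 1 = 0 := ContinuousLinearMap.ext key
  rw [← h0]
  exact hd.hasMFDerivAt

/-- The identity `u b = (g x g⁻¹) * u (x⁻¹ b) * x⁻¹` moves the question from `x` to the identity. -/
theorem hasMFDerivAt_commutator {g : G} (hg : AdModel I g = ContinuousLinearMap.id ℝ E) (x : G) :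
    HasMFDerivAt I I (fun x : G => g * x * g⁻¹ * x⁻¹) x 0 := by
  set u : G → G := fun x => g * x * g⁻¹ * x⁻¹ with hu
  have h1 : ∀ y : G, y = 1 → HasMFDerivAt I I u y 0 := by
    rintro _ rfl
    exact hasMFDerivAt_commutator_one I hg
  have hL : MDifferentiableAt I I (fun b : G => x⁻¹ * b) x :=
    (contMDiff_mul_left (I := I) (n := ∞)).mdifferentiableAt (by simp)
  have hK : ContMDiff I I ∞ (fun z : G => g * x * g⁻¹ * z * x⁻¹) :=
    (contMDiff_mul_right (a := x⁻¹)).comp (contMDiff_mul_left (a := g * x * g⁻¹))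
  have h2 := HasMFDerivAt.comp x (hK.mdifferentiableAt (by simp) (x := u (x⁻¹ * x))).hasMFDerivAt
    (HasMFDerivAt.comp x (h1 (x⁻¹ * x) (by simp)) hL.hasMFDerivAt)
  have e : (fun z : G => g * x * g⁻¹ * z * x⁻¹) ∘ u ∘ (fun b : G => x⁻¹ * b) = u := by
    ext b; simp [hu, mul_assoc]
  rw [e] at h2
  let D : E →L[ℝ] E := mfderiv I I (fun z : G => g * x * g⁻¹ * z * x⁻¹) (u (x⁻¹ * x))
  let D' : E →L[ℝ] E := mfderiv I I (fun b : G => x⁻¹ * b) x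
  have h3 : (0 : E →L[ℝ] E) = D.comp ((0 : E →L[ℝ] E).comp D') := by simp
  exact h2.congr_mfderiv h3.symm

/-- In a connected Lie group, elements with trivial adjoint action are central. -/
theorem mem_center_of_AdModel_eq_id [I.Boundaryless] [ConnectedSpace G] {g : G}
    (hg : AdModel I g = ContinuousLinearMap.id ℝ E) : g ∈ Subgroup.center G := by
  have : IsTopologicalGroup G := topologicalGroup_of_lieGroup I ∞
  have h1 := eventually_eq_of_hasMFDerivAt_zero I (hasMFDerivAt_commutator I hg) 1
  have h2 : (Subgroup.centralizer {g} : Set G) ∈ nhds (1 : G) := by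
    filter_upwards [h1] with x hx
    simp only [mul_one, mul_inv_cancel, inv_one, mul_inv_eq_one] at hx
    simp [Subgroup.mem_centralizer_iff]
    exact mul_inv_eq_iff_eq_mul.1 hx
  have h3 := Subgroup.isOpen_of_mem_nhds _ h2
  have h4 := (show IsClopen (Subgroup.centralizer {g} : Set G) from
    ⟨Subgroup.isClosed_of_isOpen _ h3, h3⟩).eq_univ ⟨1, one_mem _⟩
  rw [Subgroup.mem_center_iff]
  intro x
  have : x ∈ (Subgroup.centralizer {g} : Set G) := h4 ▸ Set.mem_univ x
  exact (Subgroup.mem_centralizer_iff.1 this g rfl).symm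

/-- If the adjoint action is faithful, so is its derivative: the adjoint action is constant along
an integral curve with initial velocity in the kernel of the derivative. -/
theorem eq_zero_of_adModel_eq_zero [CompleteSpace E] [I.Boundaryless]
    (hinj : ∀ g : G, AdModel I g = ContinuousLinearMap.id ℝ E → g = 1)
    {x : GroupLieAlgebra I G} (hx : adModel I G x = 0) : x = 0 := by
  have hsm := contMDiffAt_mulInvariantVectorField (I := I) (G := G) x (g := 1)
  obtain ⟨γ, hγ1, hγ⟩ := exists_isMIntegralCurveAt_of_contMDiffAt_boundaryless (t₀ := 0)
    (hsm.of_le (by rw [minSmoothness_of_isRCLikeNormedField]; norm_num))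
  have hd : ∀ᶠ t in nhds (0 : ℝ),
      HasDerivAt (fun t => AdModel I (γ t)) (0 : E →L[ℝ] E) t := by
    filter_upwards [hγ] with t ht
    have h1 := (HasMFDerivAt.comp t (mdifferentiableAt_AdModel I (γ t)).hasMFDerivAt
      ht).hasFDerivAt
    have h2 := mfderiv_AdModel_mulInvariantVectorField I (γ t) x
    rw [hx, ContinuousLinearMap.comp_zero] at h2
    have h0 : HasFDerivAt (fun t => AdModel I (γ t)) (0 : ℝ →L[ℝ] E →L[ℝ] E) t := by
      refine HasFDerivAt.congr_fderiv h1 (ContinuousLinearMap.ext fun c : ℝ => ?_)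
      refine (map_smul (mfderiv I 𝓘(ℝ, E →L[ℝ] E) (AdModel I (G := G)) (γ t)) c
        (mulInvariantVectorField x (γ t))).trans ?_
      exact (congrArg (fun z : E →L[ℝ] E => c • z) h2).trans (smul_zero c)
    simpa using h0.hasDerivAt
  obtain ⟨ε, hε, hball⟩ := Metric.eventually_nhds_iff_ball.1 hd
  have hconst : ∀ t ∈ Metric.ball (0 : ℝ) ε, γ t = 1 := by
    intro t ht
    apply hinj
    rw [← AdModel_one I (G := G), ← hγ1]
    exact (convex_ball (0 : ℝ) ε).is_const_of_fderivWithin_eq_zero (𝕜 := ℝ)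
      (f := fun t => AdModel I (γ t))
      (fun s hs => (hball s hs).differentiableAt.differentiableWithinAt)
      (fun s hs => by
        rw [fderivWithin_of_isOpen Metric.isOpen_ball hs, (hball s hs).hasFDerivAt.fderiv]
        ext; simp)
      ht (Metric.mem_ball_self hε)
  -- The curve is locally constant, so its velocity at `0`, which is `x`, vanishes.
  have h3 : HasMFDerivAt 𝓘(ℝ, ℝ) I γ 0 0 :=
    (hasMFDerivAt_const (1 : G) (0 : ℝ)).congr_of_eventuallyEq
      (Filter.eventually_of_mem (Metric.ball_mem_nhds 0 hε) hconst)
  have h4 := hasMFDerivAt_unique h3 hγ.self_of_nhds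
  have h5 := (DFunLike.congr_fun h4 (1 : ℝ)).symm
  have h6 : mulInvariantVectorField (I := I) x (γ 0) = 0 := (one_smul ℝ _).symm.trans h5
  rw [hγ1] at h6
  have h7 : mulInvariantVectorField (I := I) x (1 : G) = x := by
    have : (fun b : G => 1 * b) = id := by ext; simp
    unfold mulInvariantVectorField
    rw [this, mfderiv_id]
    rfl
  exact h7.symm.trans h6

/-! ### The derivative of the adjoint action is the Lie bracket. -/

theorem hasMFDerivAt_extChartAt_symm_one [I.Boundaryless] :
    HasMFDerivAt 𝓘(ℝ, E) I (extChartAt I (1 : G)).symm (extChartAt I (1 : G) 1)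
      (ContinuousLinearMap.id ℝ E) := by
  have h := (mdifferentiableWithinAt_extChartAt_symm (I := I)
    (mem_extChartAt_target (I := I) (1 : G))).hasMFDerivWithinAt
  rw [mfderivWithin_range_extChartAt_symm, I.range_eq_univ] at h
  exact hasMFDerivWithinAt_univ.1 h

/-- The derivative at the identity of a self-map of the group, read in the chart at the identity. -/
theorem hasFDerivAt_extChartAt_comp [I.Boundaryless] {f : G → G} {g : G}
    (hf : MDifferentiableAt I I f 1) (hg : f 1 = g) (hgs : g ∈ (extChartAt I (1 : G)).source) :
    HasFDerivAt (fun b => extChartAt I (1 : G) (f ((extChartAt I (1 : G)).symm b)))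
      ((mfderiv I 𝓘(ℝ, E) (extChartAt I (1 : G)) g : E →L[ℝ] E).comp
        (mfderiv I I f 1 : E →L[ℝ] E)) (extChartAt I (1 : G) 1) := by
  have h0 := hasMFDerivAt_of_eq I hf (extChartAt_to_inv (I := I) (1 : G))
  have h1 := HasMFDerivAt.comp (extChartAt I (1 : G) 1) h0 (hasMFDerivAt_extChartAt_symm_one I)
  have h2 : ∀ y, y = g → HasMFDerivAt I 𝓘(ℝ, E) (extChartAt I (1 : G)) y
      (mfderiv I 𝓘(ℝ, E) (extChartAt I (1 : G)) g : E →L[ℝ] E) := by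
    rintro _ rfl
    exact (mdifferentiableAt_extChartAt (by simpa using hgs)).hasMFDerivAt
  have h3 := (HasMFDerivAt.comp (extChartAt I (1 : G) 1)
    (h2 ((f ∘ (extChartAt I (1 : G)).symm) (extChartAt I (1 : G) 1))
      (by rw [Function.comp_apply, extChartAt_to_inv, hg])) h1).hasFDerivAt
  exact h3

theorem contDiffAt_chartMul [I.Boundaryless] :
    ContDiffAt ℝ ∞ (chartMul I G) (extChartAt I (1 : G) 1, extChartAt I (1 : G) 1) := by
  set φ := extChartAt I (1 : G) with hφ
  have hψ : ContMDiffAt 𝓘(ℝ, E) I ∞ φ.symm (φ 1) :=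
    (contMDiffOn_extChartAt_symm (1 : G)).contMDiffAt (extChartAt_target_mem_nhds (1 : G))
  have h1 : ContMDiffAt 𝓘(ℝ, E × E) I ∞ (fun p : E × E => φ.symm p.1) (φ 1, φ 1) :=
    hψ.comp (φ 1, φ 1) (f := Prod.fst) contDiff_fst.contMDiff.contMDiffAt
  have h2 : ContMDiffAt 𝓘(ℝ, E × E) I ∞ (fun p : E × E => φ.symm p.2) (φ 1, φ 1) :=
    hψ.comp (φ 1, φ 1) (f := Prod.snd) contDiff_snd.contMDiff.contMDiffAt
  have h3 := h1.mul h2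
  have h4 : ContMDiffAt I 𝓘(ℝ, E) ∞ φ (φ.symm (φ 1) * φ.symm (φ 1)) := by
    have : φ.symm (φ 1) * φ.symm (φ 1) = 1 := by simp [hφ]
    rw [this]
    exact contMDiffAt_extChartAt
  exact (ContMDiffAt.comp (φ 1, φ 1) (I' := I) h4 h3).contDiffAt

/-- Left-invariant vector fields, read in the chart at the identity. -/
theorem mpullbackWithin_mulInvariantVectorField [I.Boundaryless] (x : GroupLieAlgebra I G)
    {a : E} (ha : a ∈ (extChartAt I (1 : G)).target)
    (hd : DifferentiableAt ℝ (chartMul I G) (a, extChartAt I (1 : G) 1)) :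
    (VectorField.mpullbackWithin 𝓘(ℝ, E) I (extChartAt I (1 : G)).symm
      (mulInvariantVectorField x) (Set.range I) a : E) =
      fderiv ℝ (chartMul I G) (a, extChartAt I (1 : G) 1) (0, (x : E)) := by
  set φ := extChartAt I (1 : G) with hφ
  have hinv : (mfderivWithin 𝓘(ℝ, E) I φ.symm (Set.range I) a).inverse =
      mfderiv I 𝓘(ℝ, E) φ (φ.symm a) :=
    ContinuousLinearMap.inverse_eq (mfderivWithin_extChartAt_symm_comp_mfderiv_extChartAt ha)
      (mfderiv_extChartAt_comp_mfderivWithin_extChartAt_symm ha)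
  have hL : MDifferentiableAt I I (fun b : G => φ.symm a * b) 1 :=
    (contMDiff_mul_left (I := I) (n := ∞)).mdifferentiableAt (by simp)
  let A : E →L[ℝ] E := mfderiv I 𝓘(ℝ, E) φ (φ.symm a)
  let B : E →L[ℝ] E := mfderiv I I (fun b : G => φ.symm a * b) 1
  have h1 : HasFDerivAt (fun b => chartMul I G (a, b)) (A.comp B) (φ 1) :=
    hasFDerivAt_extChartAt_comp I hL (mul_one _) (φ.map_target ha)
  have h2 : HasFDerivAt (fun b => chartMul I G (a, b))
      ((fderiv ℝ (chartMul I G) (a, φ 1)).comp (ContinuousLinearMap.inr ℝ E E)) (φ 1) :=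
    HasFDerivAt.comp (φ 1) hd.hasFDerivAt (hasFDerivAt_prodMk_right a (φ 1))
  have h3 : ∀ v : E, A (B v) = _ := DFunLike.congr_fun (h1.unique h2)
  rw [VectorField.mpullbackWithin_apply, hinv]
  exact h3 x

theorem fderiv_chartMul_one_left [I.Boundaryless] (z : E) :
    fderiv ℝ (chartMul I G) (extChartAt I (1 : G) 1, extChartAt I (1 : G) 1) (z, 0) = z := by
  have hd := (contDiffAt_chartMul I (G := G)).differentiableAt (by simp)
  have h2 := HasFDerivAt.comp (extChartAt I (1 : G) 1)
    (f := fun a => (a, extChartAt I (1 : G) 1)) hd.hasFDerivAt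
    (hasFDerivAt_prodMk_left (𝕜 := ℝ) (extChartAt I (1 : G) 1) (extChartAt I (1 : G) 1))
  have h1 := (hasFDerivAt_id (𝕜 := ℝ) (extChartAt I (1 : G) 1)).congr_of_eventuallyEq
    (chartMul_right_one_eventuallyEq I (G := G))
  simpa using DFunLike.congr_fun (h2.unique h1) z

theorem fderiv_chartMul_one_right [I.Boundaryless] (z : E) :
    fderiv ℝ (chartMul I G) (extChartAt I (1 : G) 1, extChartAt I (1 : G) 1) (0, z) = z := by
  have hd := (contDiffAt_chartMul I (G := G)).differentiableAt (by simp)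
  have h2 := HasFDerivAt.comp (extChartAt I (1 : G) 1)
    (f := fun a => (extChartAt I (1 : G) 1, a)) hd.hasFDerivAt
    (hasFDerivAt_prodMk_right (𝕜 := ℝ) (extChartAt I (1 : G) 1) (extChartAt I (1 : G) 1))
  have h1 := (hasFDerivAt_id (𝕜 := ℝ) (extChartAt I (1 : G) 1)).congr_of_eventuallyEq
    (chartMul_left_one_eventuallyEq I (G := G))
  simpa using DFunLike.congr_fun (h2.unique h1) z

/-- Left translates and right translates are related by the adjoint action. -/
theorem fderiv_chartMul_AdModel [I.Boundaryless] (y : E) {a : E}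
    (hd : DifferentiableAt ℝ (chartMul I G) (a, extChartAt I (1 : G) 1))
    (hd' : DifferentiableAt ℝ (chartMul I G) (extChartAt I (1 : G) 1, a)) :
    fderiv ℝ (chartMul I G) (extChartAt I (1 : G) 1, a)
      (AdModel I ((extChartAt I (1 : G)).symm a) y, 0) =
      fderiv ℝ (chartMul I G) (a, extChartAt I (1 : G) 1) (0, y) := by
  set φ := extChartAt I (1 : G) with hφ
  have h2 : HasFDerivAt (fun b => chartMul I G (a, b))
      ((fderiv ℝ (chartMul I G) (a, φ 1)).comp (ContinuousLinearMap.inr ℝ E E)) (φ 1) :=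
    HasFDerivAt.comp (φ 1) hd.hasFDerivAt (hasFDerivAt_prodMk_right a (φ 1))
  set g := φ.symm a with hg
  have h3 : HasFDerivAt (φ ∘ (fun x : G => g * x * g⁻¹) ∘ φ.symm) (AdModel I g) (φ 1) := by
    refine (hasFDerivAt_extChartAt_comp I (mdifferentiableAt_conj I g 1) (g := 1) (by simp)
      (mem_extChartAt_source 1)).congr_fderiv ?_
    rw [mfderiv_extChartAt_self]
    exact ContinuousLinearMap.id_comp (AdModel I g)
  have hc : (φ ∘ (fun x : G => g * x * g⁻¹) ∘ φ.symm) (φ 1) = φ 1 := by simp [hφ]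
  have h4 : HasFDerivAt (chartMul I G) (fderiv ℝ (chartMul I G) (φ 1, a))
      ((φ ∘ (fun x : G => g * x * g⁻¹) ∘ φ.symm) (φ 1), a) := by
    rw [hc]; exact hd'.hasFDerivAt
  have h5 := HasFDerivAt.comp (φ 1)
    (f := fun b => ((φ ∘ (fun x : G => g * x * g⁻¹) ∘ φ.symm) b, a)) h4
    (h3.prodMk (hasFDerivAt_const a (φ 1)))
  -- In the group this is `g b = (g b g⁻¹) g`, valid in the chart while the conjugate stays in its
  -- domain.
  have h6 : (fun b => chartMul I G (a, b)) =ᶠ[nhds (φ 1)]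
      chartMul I G ∘ (fun b => ((φ ∘ (fun x : G => g * x * g⁻¹) ∘ φ.symm) b, a)) := by
    have hcont : ContinuousAt ((fun x : G => g * x * g⁻¹) ∘ φ.symm) (φ 1) :=
      ((contMDiff_conj I g).continuous.continuousAt).comp (continuousAt_extChartAt_symm (1 : G))
    have hsrc : φ.source ∈ nhds (((fun x : G => g * x * g⁻¹) ∘ φ.symm) (φ 1)) := by
      have : ((fun x : G => g * x * g⁻¹) ∘ φ.symm) (φ 1) = 1 := by simp [hφ]
      rw [this]
      exact extChartAt_source_mem_nhds (1 : G)
    filter_upwards [hcont hsrc] with b hb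
    have h7 : φ.symm (φ (g * φ.symm b * g⁻¹)) = g * φ.symm b * g⁻¹ := φ.left_inv hb
    simp only [chartMul, Function.comp_apply, ← hφ, h7, ← hg]
    simp
  have h8 := DFunLike.congr_fun ((h5.congr_of_eventuallyEq h6).unique h2) y
  simpa using h8

/-- The derivative of the adjoint action is the Lie bracket of the left-invariant vector fields,
read in the chart at the identity. -/
theorem adModel_apply_eq_lieBracket [I.Boundaryless] (x y : E) :
    adModel I G x y = VectorField.lieBracket ℝ
      (fun a => fderiv ℝ (chartMul I G) (a, extChartAt I (1 : G) 1) (0, x))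
      (fun a => fderiv ℝ (chartMul I G) (a, extChartAt I (1 : G) 1) (0, y))
      (extChartAt I (1 : G) 1) := by
  set φ := extChartAt I (1 : G) with hφ
  set e := φ 1 with he
  set F := fderiv ℝ (chartMul I G) with hF
  have hsm := contDiffAt_chartMul I (G := G)
  have hFd : HasFDerivAt F (fderiv ℝ F (e, e)) (e, e) :=
    ((hsm.fderiv_right (m := 1) (by norm_cast)).differentiableAt (by simp)).hasFDerivAt
  have hsymm : IsSymmSndFDerivAt ℝ (chartMul I G) (e, e) :=
    hsm.isSymmSndFDerivAt (by rw [minSmoothness_of_isRCLikeNormedField]; norm_cast)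
  have hev : ∀ᶠ p in nhds (e, e), DifferentiableAt ℝ (chartMul I G) p := by
    filter_upwards [(hsm.of_le (m := 1) (by norm_cast)).eventually (by simp)] with p hp
    exact hp.differentiableAt (by simp)
  have hevr : ∀ᶠ a in nhds e, DifferentiableAt ℝ (chartMul I G) (a, e) :=
    (Continuous.tendsto' (f := fun a : E => (a, e)) (by fun_prop) e (e, e) rfl).eventually hev
  have hevl : ∀ᶠ a in nhds e, DifferentiableAt ℝ (chartMul I G) (e, a) :=
    (Continuous.tendsto' (by fun_prop) e (e, e) rfl).eventually hev
  have htgt : ∀ᶠ a in nhds e, a ∈ φ.target := extChartAt_target_mem_nhds (1 : G)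
  have hleft : ∀ z : E, HasFDerivAt (fun a => F (a, e) (0, z))
      (((fderiv ℝ F (e, e)).comp (ContinuousLinearMap.inl ℝ E E)).flip (0, z)) e := by
    intro z
    have h1 : HasFDerivAt (fun a => F (a, e)) _ e :=
      HasFDerivAt.comp e hFd (hasFDerivAt_prodMk_left e e)
    have h2 := h1.clm_apply (hasFDerivAt_const ((0 : E), z) e)
    refine h2.congr_fderiv ?_
    ext v; simp
  have hAd : HasFDerivAt (fun a => AdModel I (φ.symm a)) (adModel I G) e := by
    set D := adModel I G with hD
    have h1 : ∀ g : G, g = 1 → HasMFDerivAt I 𝓘(ℝ, E →L[ℝ] E) (AdModel I (G := G)) g D := by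
      rintro _ rfl
      exact (mdifferentiableAt_AdModel I (1 : G)).hasMFDerivAt
    exact (HasMFDerivAt.comp e (h1 (φ.symm e) (extChartAt_to_inv (I := I) (1 : G)))
      (hasMFDerivAt_extChartAt_symm_one I)).hasFDerivAt
  have hright : HasFDerivAt (fun a => F (e, a) (AdModel I (φ.symm a) y, 0))
      (((fderiv ℝ F (e, e)).comp (ContinuousLinearMap.inr ℝ E E)).flip (y, (0 : E)) +
        (adModel I G).flip y) e := by
    have h1 : HasFDerivAt (fun a => F (e, a)) _ e :=
      HasFDerivAt.comp e hFd (hasFDerivAt_prodMk_right e e)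
    have h2 : HasFDerivAt (fun a => AdModel I (φ.symm a) y) ((adModel I G).flip y) e := by
      refine (hAd.clm_apply (hasFDerivAt_const y e)).congr_fderiv ?_
      ext v
      simp
    have h3 := h1.clm_apply (h2.prodMk (hasFDerivAt_const (0 : E) e))
    refine h3.congr_fderiv ?_
    have h4 : φ.symm e = 1 := by simp [he, hφ]
    ext v
    have h5 : F (e, e) (adModel I G v y, 0) = adModel I G v y :=
      fderiv_chartMul_one_left I _
    simp [h4, AdModel_one, h5, add_comm]
  have heq : (fun a => F (e, a) (AdModel I (φ.symm a) y, 0)) =ᶠ[nhds e]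
      (fun a => F (a, e) (0, y)) := by
    filter_upwards [hevr, hevl] with a h1 h2
    exact fderiv_chartMul_AdModel I y h1 h2
  -- Both sides of `heq` are differentiated along `x`: `F' (x, 0) (0, y) = F' (0, x) (y, 0) + ad x
  -- y`, with `F'` the second derivative of the multiplication. Its symmetry turns this into the
  -- bracket formula.
  have hkey := DFunLike.congr_fun (((hleft y).congr_of_eventuallyEq heq).unique hright) x
  rw [VectorField.lieBracket_eq]
  have hx1 : F (e, e) (0, x) = x := fderiv_chartMul_one_right I _
  have hy1 : F (e, e) (0, y) = y := fderiv_chartMul_one_right I _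
  simp only [(hleft x).fderiv, (hleft y).fderiv, hx1, hy1]
  have hs := hsymm.eq (y, (0 : E)) ((0 : E), x)
  simp only [add_apply, ContinuousLinearMap.flip_apply,
    ContinuousLinearMap.comp_apply, ContinuousLinearMap.inl_apply,
    ContinuousLinearMap.inr_apply] at hkey ⊢
  rw [hkey, ← hs]
  abel

/-- The derivative of the adjoint action is the Lie bracket. -/
theorem adModel_apply [I.Boundaryless] (x y : GroupLieAlgebra I G) :
    (adModel I G x y : E) = (⁅x, y⁆ : GroupLieAlgebra I G) := by
  set φ := extChartAt I (1 : G) with hφ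
  have hev : ∀ᶠ a in nhds (φ 1), DifferentiableAt ℝ (chartMul I G) (a, φ 1) := by
    refine (Continuous.tendsto' (f := fun a : E => (a, φ 1)) (by fun_prop) (φ 1) (φ 1, φ 1)
      rfl).eventually ?_
    filter_upwards [((contDiffAt_chartMul I (G := G)).of_le (m := 1) (by norm_cast)).eventually
      (by simp)] with p hp
    exact hp.differentiableAt (by simp)
  have hfield : ∀ z : GroupLieAlgebra I G,
      (VectorField.mpullbackWithin 𝓘(ℝ, E) I φ.symm (mulInvariantVectorField z) (Set.range I) : E → E)
        =ᶠ[nhds (φ 1)] (fun a => fderiv ℝ (chartMul I G) (a, φ 1) (0, (z : E))) := by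
    intro z
    filter_upwards [hev, extChartAt_target_mem_nhds (I := I) (1 : G)] with a h1 h2
    exact mpullbackWithin_mulInvariantVectorField I z h2 h1
  have hid : (mfderiv I 𝓘(ℝ, E) φ 1 : E →L[ℝ] E).inverse = ContinuousLinearMap.id ℝ E := by
    rw [hφ, mfderiv_extChartAt_self]
    exact ContinuousLinearMap.inverse_id
  refine (adModel_apply_eq_lieBracket I x y).trans ?_
  rw [← (hfield x).lieBracket_vectorField_eq (hfield y), GroupLieAlgebra.bracket_def,
    ← VectorField.mlieBracketWithin_univ, VectorField.mlieBracketWithin_apply]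
  have hset : φ.symm ⁻¹' Set.univ ∩ Set.range I = Set.univ := by
    rw [I.range_eq_univ, Set.preimage_univ, Set.univ_inter]
  rw [hset]
  let V (z : GroupLieAlgebra I G) : E → E :=
    VectorField.mpullbackWithin 𝓘(ℝ, E) I φ.symm (mulInvariantVectorField z) (Set.range I)
  have huniv : VectorField.lieBracket ℝ (V x) (V y) (φ 1) =
      VectorField.lieBracketWithin ℝ (V x) (V y) Set.univ (φ 1) := by
    rw [VectorField.lieBracketWithin_univ]
  exact huniv.trans (DFunLike.congr_fun hid _).symm

end LieGroup

/-! ### Positive definite forms on real vector spaces. -/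

section BilinForm

variable {V : Type*} [AddCommGroup V] [Module ℝ V]

/-- The inner product space structure of a positive definite symmetric bilinear form. -/
@[reducible]
noncomputable def LinearMap.BilinForm.innerProductCore (B : LinearMap.BilinForm ℝ V)
    (hsymm : ∀ x y, B x y = B y x) (hpos : ∀ x, x ≠ 0 → 0 < B x x) :
    InnerProductSpace.Core ℝ V where
  inner x y := B x y
  conj_inner_symm x y := hsymm y x
  re_inner_nonneg x := by
    rcases eq_or_ne x 0 with rfl | hx
    · simp
    · exact (hpos x hx).le
  add_left x y z := by simp
  smul_left x y r := by simp
  definite x hx := by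
    by_contra h
    exact (hpos x h).ne' hx

/-- The square of a nonzero skew-adjoint endomorphism has negative trace. -/
theorem LinearMap.BilinForm.trace_comp_self_neg [FiniteDimensional ℝ V]
    (B : LinearMap.BilinForm ℝ V)
    (hsymm : ∀ x y, B x y = B y x) (hpos : ∀ x, x ≠ 0 → 0 < B x x)
    {A : V →ₗ[ℝ] V} (hA : ∀ x y, B (A x) y = -B x (A y)) (hne : A ≠ 0) :
    LinearMap.trace ℝ V (A ∘ₗ A) < 0 := by
  let core := B.innerProductCore hsymm hpos
  let : NormedAddCommGroup V := core.toNormedAddCommGroup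
  let : InnerProductSpace ℝ V := InnerProductSpace.ofCore core.toCore
  let b := stdOrthonormalBasis ℝ V
  have h1 : ∀ i, inner ℝ (b i) ((A ∘ₗ A) (b i)) = -B (A (b i)) (A (b i)) := by
    intro i
    change B (b i) (A (A (b i))) = _
    rw [hA, neg_neg]
  rw [LinearMap.trace_eq_sum_inner _ b, Finset.sum_congr rfl fun i _ => h1 i,
    Finset.sum_neg_distrib, neg_lt_zero]
  have hnn : ∀ x, 0 ≤ B x x := fun x => by
    rcases eq_or_ne x 0 with rfl | hx
    · simp
    · exact (hpos x hx).le
  obtain ⟨i, hi⟩ : ∃ i, A (b i) ≠ 0 := by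
    by_contra! h
    exact hne (b.toBasis.ext fun i => by simpa using h i)
  exact Finset.sum_pos' (fun i _ => hnn _) ⟨i, Finset.mem_univ i, hpos _ hi⟩

/-- In a finite group with a faithful representation preserving a positive definite form, an
element moving every vector by an angle less than `π / 2` commutes with every element moving
vectors by angles bounded away from `arccos (7 / 8)`. -/
theorem LinearMap.BilinForm.commutatorElement_eq_one (B : LinearMap.BilinForm ℝ V)
    (hsymm : ∀ x y, B x y = B y x) (hpos : ∀ x, x ≠ 0 → 0 < B x x)
    {Γ : Type*} [Group Γ] [Finite Γ] (ρ : Γ →* (V →ₗ[ℝ] V)) (hinj : Function.Injective ρ)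
    (hρ : ∀ g v w, B (ρ g v) (ρ g w) = B v w)
    {a b : Γ} (ha : ∀ v, v ≠ 0 → 0 < B v (ρ a v))
    {c : ℝ} (hc : 7 / 8 < c) (hb : ∀ v, v ≠ 0 → c * B v v ≤ B v (ρ b v)) :
    ⁅a, b⁆ = 1 := by
  let core := B.innerProductCore hsymm hpos
  let : NormedAddCommGroup V := core.toNormedAddCommGroup
  let : InnerProductSpace ℝ V := InnerProductSpace.ofCore core.toCore
  have hin : ∀ v w, inner ℝ v w = B v w := fun _ _ => rfl
  -- By invariance `‖b v - v‖² = 2 B v v - 2 B v (b v) ≤ (2 - 2c) ‖v‖²`, and `c > 7/8` makes the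
  -- root less than `1/2`.
  refine commutatorElement_eq_one_of_displacement (d := √(2 - 2 * c)) ρ hinj hρ
    (fun v hv => by rw [hin, hsymm]; exact ha v hv) (Real.sqrt_nonneg _)
    ((Real.sqrt_lt' (by norm_num)).2 (by linarith)) fun v => ?_
  have h1 : ‖ρ b v - v‖ ^ 2 ≤ (2 - 2 * c) * ‖v‖ ^ 2 := by
    rw [← real_inner_self_eq_norm_sq, ← real_inner_self_eq_norm_sq, hin, hin]
    rcases eq_or_ne v 0 with rfl | hv
    · simp
    · have := hb v hv
      have h2 := hρ b v v
      simp only [map_sub, LinearMap.sub_apply]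
      rw [hsymm (ρ b v) v]
      linarith
  calc ‖ρ b v - v‖ ≤ √((2 - 2 * c) * ‖v‖ ^ 2) := Real.le_sqrt_of_sq_le h1
    _ = _ := by rw [Real.sqrt_mul' _ (by positivity), Real.sqrt_sq (norm_nonneg _)]

end BilinForm

/-! ### The Killing form of a compact group and the angle norm. -/

namespace LieGroup

variable {E : Type*} [NormedAddCommGroup E] [NormedSpace ℝ E] [FiniteDimensional ℝ E]
  {M : Type*} [TopologicalSpace M] (I : ModelWithCorners ℝ E M)
  {G : Type*} [TopologicalSpace G] [ChartedSpace M G] [Group G] [LieGroup I ∞ G]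

/-- The Lie algebra of a compact Lie group carries an inner product that is invariant under the
adjoint action. -/
theorem exists_AdModel_invariant_form [CompactSpace G] :
    ∃ B : LinearMap.BilinForm ℝ E, (∀ x y, B x y = B y x) ∧ (∀ x, x ≠ 0 → 0 < B x x) ∧
      ∀ (g : G) x y, B (AdModel I g x) (AdModel I g y) = B x y := by
  have : IsTopologicalGroup G := topologicalGroup_of_lieGroup I ∞
  let : MeasurableSpace G := borel G
  have : BorelSpace G := ⟨rfl⟩
  let μ : MeasureTheory.Measure G := MeasureTheory.Measure.haar
  let T : E ≃L[ℝ] EuclideanSpace ℝ (Fin (Module.finrank ℝ E)) := toEuclidean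
  -- The inverse makes acting by `h` on `x` and `y` the left translation `g ↦ h⁻¹ g`, which Haar
  -- measure absorbs.
  let f : E → E → G → ℝ := fun x y g => inner ℝ (T (AdModel I g⁻¹ x)) (T (AdModel I g⁻¹ y))
  have hcont1 : ∀ x, Continuous fun g : G => T (AdModel I g⁻¹ x) := fun x =>
    T.continuous.comp (((contMDiff_AdModel I (G := G)).continuous.comp continuous_inv).clm_apply
      continuous_const)
  have hcont : ∀ x y, Continuous (f x y) := fun x y => (hcont1 x).inner (hcont1 y)
  have hint : ∀ x y, MeasureTheory.Integrable (f x y) μ := fun x y =>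
    (hcont x y).integrable_of_hasCompactSupport (HasCompactSupport.of_compactSpace _)
  refine ⟨LinearMap.mk₂ ℝ (fun x y => ∫ g, f x y g ∂μ) ?_ ?_ ?_ ?_, ?_, ?_, ?_⟩
  · intro x x' y
    rw [← MeasureTheory.integral_add (hint _ _) (hint _ _)]
    congr 1; ext g; simp [f, inner_add_left]
  · intro c x y
    rw [smul_eq_mul, ← MeasureTheory.integral_const_mul]
    congr 1; ext g; simp [f, inner_smul_left]
  · intro x y y'
    rw [← MeasureTheory.integral_add (hint _ _) (hint _ _)]
    congr 1; ext g; simp [f, inner_add_right]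
  · intro c x y
    rw [smul_eq_mul, ← MeasureTheory.integral_const_mul]
    congr 1; ext g; simp [f, inner_smul_right]
  · intro x y
    simp only [LinearMap.mk₂_apply]
    congr 1; ext g; exact real_inner_comm _ _
  · intro x hx
    simp only [LinearMap.mk₂_apply]
    refine (hcont x x).integral_pos_of_hasCompactSupport_nonneg_nonzero
      (HasCompactSupport.of_compactSpace _) (fun g => real_inner_self_nonneg) (x := 1) ?_
    simp only [f, inv_one, AdModel_one]
    simpa using hx
  · intro h x y
    simp only [LinearMap.mk₂_apply]
    rw [← MeasureTheory.integral_mul_left_eq_self (f x y) h⁻¹]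
    congr 1; ext g
    simp [f, AdModel_mul]

/-- The derivative of the adjoint action is skew-adjoint for an invariant form. -/
theorem adModel_skew {B : LinearMap.BilinForm ℝ E}
    (hB : ∀ (g : G) x y, B (AdModel I g x) (AdModel I g y) = B x y) (x y z : E) :
    B (adModel I G x y) z = -B y (adModel I G x z) := by
  let B' : E →L[ℝ] E →L[ℝ] ℝ := LinearMap.toContinuousBilinearMap B
  let D : E →L[ℝ] E →L[ℝ] E := adModel I G
  let Φ : (E →L[ℝ] E) →L[ℝ] ℝ := (B'.flip z).comp (ContinuousLinearMap.apply ℝ E y) +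
    (B' y).comp (ContinuousLinearMap.apply ℝ E z)
  have h1 : HasFDerivAt (fun A : E →L[ℝ] E => B' (A y) (A z)) Φ (AdModel I (1 : G)) := by
    refine ((B'.hasFDerivAt.comp _ (ContinuousLinearMap.apply ℝ E y).hasFDerivAt).clm_apply
      (ContinuousLinearMap.apply ℝ E z).hasFDerivAt).congr_fderiv ?_
    ext A
    simp [Φ, AdModel_one, add_comm]
  have hD : HasMFDerivAt I 𝓘(ℝ, E →L[ℝ] E) (AdModel I (G := G)) 1 D :=
    (mdifferentiableAt_AdModel I (1 : G)).hasMFDerivAt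
  have h2 := HasMFDerivAt.comp (1 : G) h1.hasMFDerivAt hD
  -- Invariance makes this function constant on `G`, so its derivative, computed by the product
  -- rule, is zero.
  have h3 : (fun A : E →L[ℝ] E => B' (A y) (A z)) ∘ AdModel I (G := G) = fun _ => B y z := by
    ext g
    exact hB g y z
  rw [h3] at h2
  have h4 := hasMFDerivAt_unique h2 (hasMFDerivAt_const (B y z) (1 : G))
  have h5 : Φ (D x) = 0 := DFunLike.congr_fun h4 x
  exact eq_neg_of_add_eq_zero_left h5

/-- The negative of the Killing form, in terms of the derivative of the adjoint action. -/
theorem killingInner_eq_trace [I.Boundaryless] (x y : E) :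
    killingInner I (G := G) x y =
      -LinearMap.trace ℝ E ((adModel I G x).toLinearMap * (adModel I G y).toLinearMap) := by
  have h : ∀ z : E, @Eq (E →ₗ[ℝ] E) (LieAlgebra.ad ℝ (GroupLieAlgebra I G) z)
      (adModel I G z).toLinearMap :=
    fun z => LinearMap.ext fun w => (adModel_apply I z w).symm
  rw [← h, ← h]
  rfl

/-- The negative of the Killing form is invariant under the adjoint action. -/
theorem killingInner_AdModel [I.Boundaryless] (g : G) (x y : E) :
    killingInner I (G := G) (AdModel I g x) (AdModel I g y) = killingInner I (G := G) x y := by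
  have h : ∀ z : E, (adModel I G (AdModel I g z) : E →L[ℝ] E).toLinearMap =
      (AdModel I g).toLinearMap * (adModel I G z).toLinearMap * (AdModel I g⁻¹).toLinearMap := by
    intro z
    rw [adModel_Ad]
    rfl
  have hinv : (AdModel I g⁻¹).toLinearMap * (AdModel I g).toLinearMap = 1 := by
    have := AdModel_mul I g⁻¹ g
    rw [inv_mul_cancel, AdModel_one] at this
    exact congrArg ContinuousLinearMap.toLinearMap this.symm
  rw [killingInner_eq_trace, killingInner_eq_trace, neg_inj]
  rw [h, h]
  set A := (AdModel I g).toLinearMap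
  set A' := (AdModel I g⁻¹).toLinearMap
  set X := (adModel I G x).toLinearMap
  set Y := (adModel I G y).toLinearMap
  calc LinearMap.trace ℝ E (A * X * A' * (A * Y * A'))
      = LinearMap.trace ℝ E (A * (X * (A' * A) * Y * A')) := by simp only [mul_assoc]
    _ = LinearMap.trace ℝ E (X * (A' * A) * Y * A' * A) := LinearMap.trace_mul_comm _ _ _
    _ = LinearMap.trace ℝ E (X * (A' * A) * Y * (A' * A)) := by simp only [mul_assoc]
    _ = _ := by rw [hinv, mul_one, mul_one]

theorem killingInner_Ad [I.Boundaryless] (g : G) (x y : GroupLieAlgebra I G) :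
    killingInner I (Ad I g x) (Ad I g y) = killingInner I x y :=
  killingInner_AdModel I g x y

/-- The negative of the Killing form of a compact connected Lie group with trivial center is
positive definite. -/
theorem killingInner_self_pos [I.Boundaryless] [CompactSpace G] [ConnectedSpace G]
    (hcenter : Subgroup.center G = ⊥) {x : E} (hx : x ≠ 0) :
    0 < killingInner I (G := G) x x := by
  obtain ⟨B, hsymm, hpos, hB⟩ := exists_AdModel_invariant_form I (G := G)
  rw [killingInner_eq_trace, neg_pos]
  refine B.trace_comp_self_neg hsymm hpos (fun y z => adModel_skew I hB x y z) fun h0 => hx ?_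
  have : CompleteSpace E := FiniteDimensional.complete ℝ E
  refine eq_zero_of_adModel_eq_zero I (fun g hg => ?_) (ContinuousLinearMap.coe_injective h0)
  have := mem_center_of_AdModel_eq_id I hg
  rwa [hcenter, Subgroup.mem_bot] at this

theorem killingAngle_le_opNorm (g : G) {v : GroupLieAlgebra I G} (hv : killingNorm I v = 1) :
    killingAngle I v (Ad I g v) ≤ opNorm I g := by
  refine le_csSup ⟨Real.pi, ?_⟩ ⟨v, hv, rfl⟩
  rintro _ ⟨y, -, rfl⟩
  exact Real.arccos_le_pi _

theorem opNorm_nonneg (g : G) : 0 ≤ opNorm I g := by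
  refine Real.sSup_nonneg ?_
  rintro _ ⟨y, -, rfl⟩
  exact Real.arccos_nonneg _

/-- Rescaling `v` to unit length reduces to the supremum, and `Ad g` preserves that length. -/
theorem arccos_le_opNorm [I.Boundaryless] (g : G) {v : GroupLieAlgebra I G}
    (hv : 0 < killingInner I v v) :
    Real.arccos (killingInner I v (Ad I g v) / killingInner I v v) ≤ opNorm I g := by
  set N := killingNorm I v with hN
  have hN2 : N * N = killingInner I v v := Real.mul_self_sqrt hv.le
  have hN0 : 0 < N := Real.sqrt_pos.2 hv
  have hsm : ∀ y z : GroupLieAlgebra I G, killingInner I (N⁻¹ • y) (N⁻¹ • z) =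
      killingInner I y z / killingInner I v v := by
    intro y z
    rw [← hN2]
    simp only [killingInner, map_smul, LinearMap.smul_apply, smul_eq_mul]
    field_simp
  have hunit : killingNorm I (N⁻¹ • v) = 1 := by
    rw [killingNorm, hsm, div_self hv.ne', Real.sqrt_one]
  have hunit' : killingNorm I (Ad I g (N⁻¹ • v)) = 1 := by
    rw [killingNorm, killingInner_Ad, ← killingNorm, hunit]
  have h := killingAngle_le_opNorm I g hunit
  rw [killingAngle, hunit, hunit', map_smul, hsm] at h
  simpa using h

end LieGroup

/-! ### The commutation theorem. -/

theorem theorem2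
    {E : Type*} [NormedAddCommGroup E] [NormedSpace ℝ E] [FiniteDimensional ℝ E]
    {M : Type*} [TopologicalSpace M] (I : ModelWithCorners ℝ E M) [I.Boundaryless]
    {G : Type*} [TopologicalSpace G] [ChartedSpace M G] [Group G] [LieGroup I ∞ G]
    [T2Space G] [CompactSpace G] [ConnectedSpace G]
    (hcenter : Subgroup.center G = ⊥)
    (α : ℝ) (hα : IsLeast {a : ℝ | 0 < a ∧ Real.cos a = 7 / 8} α)
    (H : Subgroup G) [DiscreteTopology H]
    (h k : G) (hh : h ∈ H) (hk : k ∈ H)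
    (hnorm : LieGroup.opNorm I h < Real.pi / 2)
    (knorm : LieGroup.opNorm I k < α) :
    ⁅h, k⁆ = 1 := by
  have : IsTopologicalGroup G := topologicalGroup_of_lieGroup I ∞
  have : CompactSpace H :=
    isCompact_iff_compactSpace.1 (Subgroup.isClosed_of_discrete (H := H)).isCompact
  have : Finite H := finite_of_compact_of_discrete
  let B : LinearMap.BilinForm ℝ E := -killingForm ℝ (GroupLieAlgebra I G)
  let ρ : H →* (E →ₗ[ℝ] E) :=
    { toFun := fun g => (LieGroup.AdModel I (g : G)).toLinearMap
      map_one' := congrArg ContinuousLinearMap.toLinearMap (LieGroup.AdModel_one I (G := G))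
      map_mul' := fun g g' =>
        congrArg ContinuousLinearMap.toLinearMap
          (LieGroup.AdModel_mul I (g : G) g') }
  have hinj : Function.Injective ρ := by
    rw [injective_iff_map_eq_one]
    intro g hg
    have h1 := LieGroup.mem_center_of_AdModel_eq_id I (g := (g : G))
      (ContinuousLinearMap.coe_injective hg)
    rw [hcenter, Subgroup.mem_bot] at h1
    exact Subtype.ext h1
  have hpos : ∀ x, x ≠ 0 → 0 < B x x := fun x hx => LieGroup.killingInner_self_pos I hcenter hx
  have hsymm : ∀ x y, B x y = B y x := fun x y =>
    congrArg Neg.neg (LieModule.traceForm_comm ℝ (GroupLieAlgebra I G) (GroupLieAlgebra I G) x y)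
  -- Minimality of `α` against `arccos (7/8)` places it where cosine is decreasing.
  have hαπ : α ≤ Real.pi :=
    (hα.2 ⟨Real.arccos_pos.2 (by norm_num), Real.cos_arccos (by norm_num) (by norm_num)⟩).trans
      (Real.arccos_le_pi (7 / 8))
  have hcos : 7 / 8 < Real.cos (LieGroup.opNorm I k) := by
    rw [← hα.1.2]
    exact Real.cos_lt_cos_of_nonneg_of_le_pi (LieGroup.opNorm_nonneg I k) hαπ knorm
  have key := B.commutatorElement_eq_one hsymm hpos ρ hinj
    (fun g v w => LieGroup.killingInner_Ad I (g : G) v w) (a := ⟨h, hh⟩) (b := ⟨k, hk⟩)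
    (fun v hv => ?_) hcos (fun v hv => ?_)
  · exact congrArg Subtype.val key
  · have h1 := (LieGroup.arccos_le_opNorm I h (hpos v hv)).trans_lt hnorm
    exact (div_pos_iff_of_pos_right (hpos v hv)).1 (Real.arccos_lt_pi_div_two.1 h1)
  · refine (le_div_iff₀ (hpos v hv)).1 ?_
    set t := B v (LieGroup.AdModel I k v) / B v v
    have h1 : Real.arccos t ≤ LieGroup.opNorm I k := LieGroup.arccos_le_opNorm I k (hpos v hv)
    change _ ≤ t
    have h2 : Real.cos (LieGroup.opNorm I k) ≤ Real.cos (Real.arccos t) :=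
      Real.cos_le_cos_of_nonneg_of_le_pi (Real.arccos_nonneg _) (knorm.le.trans hαπ) h1
    -- `Real.arccos` is clamped to `π` below `-1`, which would contradict `opNorm I k < α ≤ π`.
    -- Above `1` the bound is immediate from `cos ≤ 1`. Hence Cauchy–Schwarz is not needed.
    have h3 : -1 ≤ t := by
      by_contra! hlt
      rw [Real.arccos_of_le_neg_one hlt.le] at h1
      linarith
    rcases le_total t 1 with h4 | h4
    · rwa [Real.cos_arccos h3 h4] at h2
    · exact (Real.cos_le_one _).trans h4
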